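/- All graphs are finite, simple and have at least one vertex. For a graph $F$, a graph is called $F$-free if it has no induced subgraph isomorphic to $F$; $C_k$ denotes the cycle with $k$ vertices. For a graph $G$ with distinct vertices $a,b$, the shortest path graph $S(G,a,b)$ is the graph whose vertices are the shortest paths from $a$ to $b$ in $G$ (the $(a,b)$-geodesics), two of them being adjacent if and only if they differ in exactly one vertex. A graph $H$ is a shortest path graph if $H\cong S(G,a,b)$ for some graph $G$ and distinct vertices $a,b$ of $G$; then $G$ (with $a,b$) is called a base graph of $H$. It has $n$ index levels if the distance from $a$ to $b$ in $G$ is $n+1$, so that the $(a,b)$-geodesics have the form $a v_1\cdots v_n b$. A collection of cliques is a graph that is claw-free (that is, $K_{1,3}$-free) and in which any two distinct maximal cliques have at most one vertex in common. Theorem. Let $H$ be a $C_4$-free graph. Then $H$ is a shortest path graph if and only if $H$ is a collection of cliques that is $C_k$-free for all odd $k\ge 5$. Furthermore, if $H$ is a shortest path graph, then it has a base graph with exactly two index levels. -/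

import Mathlib

universe u v

namespace ShortestPathGraph

/-- `H` is `F`-free in the induced sense: no induced subgraph of `H` is isomorphic to `F`. -/
def InducedFree {U : Type u} {V : Type v} (F : SimpleGraph U) (H : SimpleGraph V) : Prop :=
  ¬ SimpleGraph.IsIndContained F H

/-- The `(a,b)`-geodesics of `G`: walks from `a` to `b` whose length is the distance from `a` to `b`
(such walks are automatically paths; there are none when `b` is not reachable from `a`). -/
def Geodesic {W : Type u} (G : SimpleGraph W) (a b : W) : Type u :=
  {p : G.Walk a b // p.length = G.dist a b}

/-- The set of positions at which two `(a,b)`-geodesics differ. (Both start at `a`, and both are at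
`b` from position `G.dist a b` on, so only positions strictly in between can occur.) -/
def diffIndexSet {W : Type u} {G : SimpleGraph W} {a b : W} (P Q : Geodesic G a b) : Set ℕ :=
  {i | P.1.getVert i ≠ Q.1.getVert i}

/-- The shortest path graph `S(G,a,b)`: its vertices are the `(a,b)`-geodesics of `G`, and two of
them are adjacent iff they differ in exactly one vertex. -/
def shortestPathGraph {W : Type u} (G : SimpleGraph W) (a b : W) :
    SimpleGraph (Geodesic G a b) where
  Adj P Q := (diffIndexSet P Q).ncard = 1
  symm := ⟨fun P Q h => by
    have e : diffIndexSet Q P = diffIndexSet P Q := by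
      ext i
      exact ne_comm
    rw [e]
    exact h⟩
  loopless := ⟨fun P h => by simp [diffIndexSet] at h⟩

/-- `G`, with the distinct vertices `a` and `b`, is a base graph of `H`: `H ≅ S(G,a,b)`. -/
def IsBaseGraph {W : Type u} {V : Type v} (G : SimpleGraph W) (a b : W) (H : SimpleGraph V) :
    Prop :=
  a ≠ b ∧ Nonempty (H ≃g shortestPathGraph G a b)

/-- The `(a,b)`-geodesics of `G` have `n` index levels, that is, they have the form
`a v₁ … vₙ b`: the distance from `a` to `b` is finite and equal to `n + 1`. -/
def HasIndexLevels {W : Type u} (G : SimpleGraph W) (a b : W) (n : ℕ) : Prop :=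
  G.Reachable a b ∧ G.dist a b = n + 1

/-- `H` is a shortest path graph: it has a (finite) base graph. -/
def IsSPG {V : Type u} (H : SimpleGraph V) : Prop :=
  ∃ (W : Type u) (_ : Finite W) (G : SimpleGraph W) (a b : W), IsBaseGraph G a b H

/-- `H` is a collection of cliques: it is claw-free and any two distinct maximal cliques share at
most one vertex. -/
def IsCollectionOfCliques {V : Type u} (H : SimpleGraph V) : Prop :=
  InducedFree (completeBipartiteGraph (Fin 1) (Fin 3)) H ∧
    ∀ s t : Set V, Maximal H.IsClique s → Maximal H.IsClique t → s ≠ t → (s ∩ t).encard ≤ 1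

end ShortestPathGraph

/-! A geodesic is a word of vertices, and an edge of the shortest path graph changes one letter, so
each edge has an index; the edges of a triangle share theirs. Changes at two non-neighbouring
indices commute, which would produce an induced 4-cycle (`index_le_succ`). So the edges at a vertex
use at most two indices, which are then consecutive: there is no claw, and along a hole the index
alternates in parity. Conversely, in a collection of cliques every vertex lies in at most two
maximal cliques, and an odd cycle in their intersection graph would yield an odd hole. That graph is
thus bipartite, and its two colour classes give two partitions of the vertices, encoded by maps `f`
and `g` (`exists_two_maps`). Sending `x` to the geodesic through `f x` and `g x` gives a base graph
with two levels (`isBaseGraph_twoLevelGraph`), which also settles the last claim. -/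

namespace ShortestPathGraph

open SimpleGraph

/-! ### Necessity: words and the indices of edges. -/

section WordRepresentation

variable {V : Type u} {W : Type v}

/-- `f` and `g` differ at position `i` and nowhere else. -/
def DifferOnlyAt (f g : ℕ → W) (i : ℕ) : Prop :=
  f i ≠ g i ∧ ∀ j, j ≠ i → f j = g j

/-- A representation of the vertices of `H` by words such that adjacency means differing in exactly
one position, and changes at two positions that are not neighbours can be carried out together. -/
structure WordRepresentation (H : SimpleGraph V) (W : Type v) where
  word : V → ℕ → W
  injective : Function.Injective word
  adj_iff : ∀ x y, H.Adj x y ↔ ∃ i, DifferOnlyAt (word x) (word y) i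
  exchange : ∀ x y z i k, DifferOnlyAt (word x) (word y) i → DifferOnlyAt (word x) (word z) k →
    (i + 1 < k ∨ k + 1 < i) → ∃ t, ∀ j, word t j = if j = k then word z j else word y j

theorem DifferOnlyAt.symm {f g : ℕ → W} {i : ℕ} (h : DifferOnlyAt f g i) : DifferOnlyAt g f i :=
  ⟨h.1.symm, fun j hj => (h.2 j hj).symm⟩

theorem DifferOnlyAt.eq_or_differOnlyAt {f g h : ℕ → W} {i : ℕ} (hg : DifferOnlyAt f g i)
    (hh : DifferOnlyAt f h i) : g = h ∨ DifferOnlyAt g h i := by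
  have hoff : ∀ j, j ≠ i → g j = h j := fun j hj => (hg.2 j hj).symm.trans (hh.2 j hj)
  by_cases hi : g i = h i
  · left
    funext j
    by_cases hj : j = i
    · rw [hj, hi]
    · exact hoff j hj
  · exact .inr ⟨hi, hoff⟩

/-- Three words that pairwise differ in one position differ in the same position. -/
theorem DifferOnlyAt.index_eq {f g h : ℕ → W} {i j k : ℕ} (hg : DifferOnlyAt f g i)
    (hh : DifferOnlyAt f h j) (hgh : DifferOnlyAt g h k) : j = i := by
  by_contra hne
  have hi : g i ≠ h i := by
    rw [← hh.2 i (Ne.symm hne)]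
    exact hg.1.symm
  have hj : g j ≠ h j := by
    rw [← hg.2 j hne]
    exact hh.1
  have hik : i = k := by
    by_contra h
    exact hi (hgh.2 i h)
  have hjk : j = k := by
    by_contra h
    exact hj (hgh.2 j h)
  exact hne (hjk.trans hik.symm)

theorem not_inducedFree_cycleGraph_four {H : SimpleGraph V} {p q r s : V} (hpq : H.Adj p q)
    (hqr : H.Adj q r) (hrs : H.Adj r s) (hsp : H.Adj s p) (hpr : ¬ H.Adj p r) (hqs : ¬ H.Adj q s)
    (hpr' : p ≠ r) (hqs' : q ≠ s) : ¬ InducedFree (cycleGraph 4) H := by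
  refine not_not.2 ⟨⟨⟨![p, q, r, s], ?_⟩, ?_⟩⟩
  · intro i j
    fin_cases i <;> fin_cases j <;>
      simp [hpq.ne, hpq.ne', hqr.ne, hqr.ne', hrs.ne, hrs.ne', hsp.ne, hsp.ne', hpr', hqs',
        hpr'.symm, hqs'.symm]
  · intro i j
    change H.Adj (![p, q, r, s] i) (![p, q, r, s] j) ↔ _
    have hrp : ¬ H.Adj r p := fun h => hpr h.symm
    have hsq : ¬ H.Adj s q := fun h => hqs h.symm
    fin_cases i <;> fin_cases j <;>
      simp [hpq, hpq.symm, hqr, hqr.symm, hrs, hrs.symm, hsp, hsp.symm, hpr, hqs, hrp, hsq,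
        cycleGraph_adj] <;> decide

namespace WordRepresentation

variable {H : SimpleGraph V}

theorem eq_or_adj (w : WordRepresentation H W)
    {x y z : V} {i : ℕ} (hy : DifferOnlyAt (w.word x) (w.word y) i)
    (hz : DifferOnlyAt (w.word x) (w.word z) i) : y = z ∨ H.Adj y z :=
  (hy.eq_or_differOnlyAt hz).imp (fun h => w.injective h) fun h => (w.adj_iff y z).2 ⟨i, h⟩

/-- Otherwise carrying out both changes gives a vertex `t`, and `x`, `y`, `t`, `z` form an induced
4-cycle. -/
theorem index_le_succ (w : WordRepresentation H W)
    (hH : InducedFree (cycleGraph 4) H) {x y z : V} {i k : ℕ}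
    (hy : DifferOnlyAt (w.word x) (w.word y) i) (hz : DifferOnlyAt (w.word x) (w.word z) k) :
    i ≤ k + 1 ∧ k ≤ i + 1 := by
  by_contra hfar
  have hfar' : i + 1 < k ∨ k + 1 < i := by omega
  have hik : i ≠ k := by omega
  obtain ⟨t, ht⟩ := w.exchange x y z i k hy hz hfar'
  have hyt : DifferOnlyAt (w.word y) (w.word t) k := by
    refine ⟨?_, fun j hj => by rw [ht, if_neg hj]⟩
    rw [ht, if_pos rfl, ← hy.2 k hik.symm]
    exact hz.1
  have hzt : DifferOnlyAt (w.word z) (w.word t) i := by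
    refine ⟨?_, fun j hj => ?_⟩
    · rw [ht, if_neg hik, ← hz.2 i hik]
      exact hy.1
    · rw [ht]
      split_ifs with hjk
      · rfl
      · rw [← hy.2 j hj, hz.2 j hjk]
  have hxt : ∀ m, ¬ DifferOnlyAt (w.word x) (w.word t) m := fun m h => by
    have h1 := hy.index_eq h hyt
    have h2 := hz.index_eq h hzt
    omega
  have hyz : ∀ m, ¬ DifferOnlyAt (w.word y) (w.word z) m := fun m h =>
    hik (hy.index_eq hz h).symm
  refine not_inducedFree_cycleGraph_four ((w.adj_iff x y).2 ⟨_, hy⟩) ((w.adj_iff y t).2 ⟨_, hyt⟩)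
    ((w.adj_iff t z).2 ⟨_, hzt.symm⟩) ((w.adj_iff z x).2 ⟨_, hz.symm⟩)
    (fun h => ?_) (fun h => ?_) ?_ ?_ hH
  · obtain ⟨m, hm⟩ := (w.adj_iff x t).1 h
    exact hxt m hm
  · obtain ⟨m, hm⟩ := (w.adj_iff y z).1 h
    exact hyz m hm
  · rintro rfl
    exact hyt.1 (hy.2 k hik.symm).symm
  · rintro rfl
    exact hy.1 (hz.2 i hik)

/-- The leaves would need three distinct indices, pairwise at distance at most one. -/
theorem inducedFree_claw (w : WordRepresentation H W) (hH : InducedFree (cycleGraph 4) H) :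
    InducedFree (completeBipartiteGraph (Fin 1) (Fin 3)) H := by
  rintro ⟨φ⟩
  have hadj : ∀ i : Fin 3, H.Adj (φ (.inl 0)) (φ (.inr i)) := fun i =>
    φ.map_adj_iff.2 (by simp)
  choose c hc using fun i => (w.adj_iff _ _).1 (hadj i)
  have hne : ∀ i j, i ≠ j → c i ≠ c j := by
    intro i j hij hcij
    rcases w.eq_or_adj (hc i) (hcij ▸ hc j) with h | h
    · exact hij (Sum.inr_injective (φ.injective h))
    · exact absurd (φ.map_adj_iff.1 h) (by simp)
  have h01 := w.index_le_succ hH (hc 0) (hc 1)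
  have h02 := w.index_le_succ hH (hc 0) (hc 2)
  have h12 := w.index_le_succ hH (hc 1) (hc 2)
  have n01 := hne 0 1 (by decide)
  have n02 := hne 0 2 (by decide)
  have n12 := hne 1 2 (by decide)
  omega

theorem maximal_isClique_inter (w : WordRepresentation H W)
    {s t : Set V} (hs : Maximal H.IsClique s)
    (ht : Maximal H.IsClique t) (hst : s ≠ t) : (s ∩ t).encard ≤ 1 := by
  rw [Set.encard_le_one_iff]
  intro x y hx hy
  by_contra hxy
  obtain ⟨i, hi⟩ := (w.adj_iff x y).1 (hs.prop hx.1 hy.1 hxy)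
  -- The words agreeing with `x` off index `i` form a clique that contains every clique through `x`
  -- and `y`, because triangles have a single index.
  have hline : H.IsClique {z | ∀ j, j ≠ i → w.word x j = w.word z j} := by
    intro y hy z hz hyz
    have hoff : ∀ j, j ≠ i → w.word y j = w.word z j := fun j hj => (hy j hj).symm.trans (hz j hj)
    refine (w.adj_iff y z).2 ⟨i, fun h => hyz (w.injective ?_), hoff⟩
    funext j
    by_cases hj : j = i
    · rw [hj, h]
    · exact hoff j hj
  have key : ∀ r : Set V, Maximal H.IsClique r → x ∈ r → y ∈ r →
      r = {z | ∀ j, j ≠ i → w.word x j = w.word z j} := by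
    intro r hr hxr hyr
    refine hr.eq_of_subset hline fun z hz => ?_
    by_cases hxz : x = z
    · subst hxz
      exact fun j _ => rfl
    by_cases hyz : y = z
    · subst hyz
      exact hi.2
    obtain ⟨j, hj⟩ := (w.adj_iff x z).1 (hr.prop hxr hz hxz)
    obtain ⟨k, hk⟩ := (w.adj_iff y z).1 (hr.prop hyr hz hyz)
    rw [hi.index_eq hj hk] at hj
    exact hj.2
  exact hst ((key s hs hx.1 hy.1).trans (key t ht hx.2 hy.2).symm)

theorem inducedFree_cycleGraph_of_odd (w : WordRepresentation H W)
    (hH : InducedFree (cycleGraph 4) H) {k : ℕ} (hk : Odd k)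
    (hk5 : 5 ≤ k) : InducedFree (cycleGraph k) H := by
  obtain ⟨n, rfl⟩ : ∃ n, k = n + 4 := ⟨k - 4, by omega⟩
  rintro ⟨φ⟩
  have hadj : ∀ i : Fin (n + 4), H.Adj (φ i) (φ (i + 1)) := fun i =>
    φ.map_adj_iff.2 (cycleGraph_adj.2 (.inr (by simp)))
  choose c hc using fun i => (w.adj_iff _ _).1 (hadj i)
  have two_ne_zero : (1 + 1 : Fin (n + 4)) ≠ 0 := by
    simp [Fin.ext_iff, Fin.val_add, Nat.mod_eq_of_lt (show 2 < n + 4 by omega)]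
  have two_ne_one : (1 + 1 : Fin (n + 4)) ≠ 1 := by simp
  have three_ne_zero : (1 + (1 + 1) : Fin (n + 4)) ≠ 0 := by
    simp [Fin.ext_iff, Fin.val_add, Nat.mod_eq_of_lt (show 3 < n + 4 by omega)]
  -- Consecutive edges have different indices, since equal ones would give a chord (or make two
  -- vertices equal); being at distance one, the indices differ in parity. Going once round then
  -- forces even length.
  have hstep : ∀ i, c (i + 1) % 2 ≠ c i % 2 := by
    intro i
    have hle := w.index_le_succ hH (hc i).symm (hc (i + 1))
    have hne : c (i + 1) ≠ c i := by
      intro h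
      rcases w.eq_or_adj (hc i).symm (h ▸ hc (i + 1)) with h | h
      · have := φ.injective h
        rw [add_assoc, left_eq_add] at this
        exact two_ne_zero this
      · rcases cycleGraph_adj.1 (φ.map_adj_iff.1 h) with h' | h'
        · rw [sub_eq_iff_eq_add, add_assoc i 1 1, add_left_comm 1 i, left_eq_add] at h'
          exact three_ne_zero h'
        · rw [add_assoc i 1 1, add_sub_cancel_left] at h'
          exact two_ne_one h'
    omega
  have hpar : ∀ m : ℕ, c (Fin.ofNat (n + 4) m) % 2 = (c (Fin.ofNat (n + 4) 0) + m) % 2 := by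
    intro m
    induction m with
    | zero => rfl
    | succ m ih =>
      have hsucc : Fin.ofNat (n + 4) (m + 1) = Fin.ofNat (n + 4) m + 1 := by
        simp [Fin.ext_iff, Fin.val_add]
      have := hstep (Fin.ofNat (n + 4) m)
      rw [hsucc]
      omega
  have hlast := hpar (n + 4)
  have hcycle : Fin.ofNat (n + 4) (n + 4) = Fin.ofNat (n + 4) 0 := by simp
  rw [hcycle] at hlast
  obtain ⟨r, hr⟩ := hk
  omega

end WordRepresentation

end WordRepresentation

/-! ### Geodesics as words. -/

section Geodesic

variable {W : Type u} {G : SimpleGraph W} {a b : W}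

theorem exists_walk_getVert_eq (f : ℕ → W) (n : ℕ) (hf : ∀ i < n, G.Adj (f i) (f (i + 1))) :
    ∃ p : G.Walk (f 0) (f n), p.length = n ∧ ∀ i ≤ n, p.getVert i = f i := by
  induction n generalizing f with
  | zero => exact ⟨.nil, rfl, fun i hi => by simp [Nat.le_zero.1 hi]⟩
  | succ n ih =>
    obtain ⟨p, hp, hpf⟩ := ih (fun i => f (i + 1)) fun i hi => hf (i + 1) (by omega)
    refine ⟨.cons (hf 0 (by omega)) p, by simp [hp], fun i hi => ?_⟩
    cases i with
    | zero => simp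
    | succ i => exact hpf i (by omega)

theorem Geodesic.ext {P Q : Geodesic G a b} (h : ∀ i, P.1.getVert i = Q.1.getVert i) : P = Q :=
  Subtype.ext (Walk.ext_getVert h)

theorem Geodesic.getVert_of_dist_le (P : Geodesic G a b) {i : ℕ} (hi : G.dist a b ≤ i) :
    P.1.getVert i = b :=
  P.1.getVert_of_length_le (P.2.trans_le hi)

theorem Geodesic.adj_getVert_succ (P : Geodesic G a b) {i : ℕ} (hi : i < G.dist a b) :
    G.Adj (P.1.getVert i) (P.1.getVert (i + 1)) :=
  P.1.adj_getVert_succ (hi.trans_eq P.2.symm)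

/-- A walk of length `G.dist a b` is automatically a geodesic, so only consecutive adjacency
matters. The constant tail matches `getVert`, which stays at `b` past the end. -/
theorem Geodesic.exists_getVert_eq (f : ℕ → W) (h0 : f 0 = a)
    (hb : ∀ i, G.dist a b ≤ i → f i = b)
    (hf : ∀ i < G.dist a b, G.Adj (f i) (f (i + 1))) :
    ∃ P : Geodesic G a b, ∀ i, P.1.getVert i = f i := by
  obtain ⟨p, hp, hpf⟩ := exists_walk_getVert_eq f _ hf
  refine ⟨⟨p.copy h0 (hb _ le_rfl), by simpa using hp⟩, fun i => ?_⟩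
  rcases le_total i (G.dist a b) with hi | hi
  · simpa using hpf i hi
  · rw [hb i hi]
    exact Geodesic.getVert_of_dist_le _ hi

theorem shortestPathGraph_adj_iff {P Q : Geodesic G a b} :
    (shortestPathGraph G a b).Adj P Q ↔ ∃ i, DifferOnlyAt P.1.getVert Q.1.getVert i := by
  change (diffIndexSet P Q).ncard = 1 ↔ _
  rw [Set.ncard_eq_one]
  refine exists_congr fun i => ?_
  rw [Set.eq_singleton_iff_unique_mem]
  refine and_congr Iff.rfl (forall_congr' fun j => ?_)
  change (P.1.getVert j ≠ Q.1.getVert j → j = i) ↔ _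
  tauto

/-- Two consecutive positions never contain both `i` and `k`, so each consecutive pair of the new
word already occurs in `Q` or in `R`. -/
theorem Geodesic.exists_exchange {P Q R : Geodesic G a b} {i k : ℕ}
    (hQ : DifferOnlyAt P.1.getVert Q.1.getVert i) (hR : DifferOnlyAt P.1.getVert R.1.getVert k)
    (hik : i + 1 < k ∨ k + 1 < i) :
    ∃ T : Geodesic G a b, ∀ j,
      T.1.getVert j = if j = k then R.1.getVert j else Q.1.getVert j := by
  refine Geodesic.exists_getVert_eq _ (by simp) (fun j hj => ?_) fun j hj => ?_
  · rw [Q.getVert_of_dist_le hj, R.getVert_of_dist_le hj, ite_self]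
  · by_cases hjk : j = k
    · rw [if_pos hjk, if_neg (by omega), ← hQ.2 (j + 1) (by omega), hR.2 (j + 1) (by omega)]
      exact R.adj_getVert_succ hj
    · by_cases hjk' : j + 1 = k
      · rw [if_neg hjk, if_pos hjk', ← hQ.2 j (by omega), hR.2 j hjk]
        exact R.adj_getVert_succ hj
      · rw [if_neg hjk, if_neg hjk']
        exact Q.adj_getVert_succ hj

theorem IsBaseGraph.nonempty_wordRepresentation {V : Type v} {H : SimpleGraph V}
    (h : IsBaseGraph G a b H) : Nonempty (WordRepresentation H W) := by
  obtain ⟨-, ⟨e⟩⟩ := h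
  refine ⟨⟨fun x => (e x).1.getVert, fun x y hxy => ?_, fun x y => ?_, fun x y z i k hy hz hik => ?_⟩⟩
  · exact e.injective (Geodesic.ext (congrFun hxy))
  · rw [← e.map_adj_iff, shortestPathGraph_adj_iff]
  · obtain ⟨T, hT⟩ := Geodesic.exists_exchange hy hz hik
    exact ⟨e.symm T, by simpa using hT⟩

end Geodesic

/-! ### Sufficiency: the base graph with two levels. -/

section TwoLevels

variable {V : Type u}

/-- The graph with vertices `a = inl none`, `b = inr none`, the first level `inl (some u)` and the
second level `inr (some u)`, where `f x` and `g x` are joined for every `x`. -/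
def twoLevelGraph (f g : V → V) : SimpleGraph (Option V ⊕ Option V) where
  Adj
    | .inl none, .inl (some _) => True
    | .inl (some _), .inl none => True
    | .inr none, .inr (some _) => True
    | .inr (some _), .inr none => True
    | .inl (some u), .inr (some w) => ∃ x, f x = u ∧ g x = w
    | .inr (some w), .inl (some u) => ∃ x, f x = u ∧ g x = w
    | _, _ => False
  symm := ⟨by rintro ((_ | _) | (_ | _)) ((_ | _) | (_ | _)) <;> simp⟩
  loopless := ⟨by rintro ((_ | _) | (_ | _)) <;> simp⟩

/-- The vertices of the walk through `f x` and `g x`. -/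
def twoLevelWord (f g : V → V) (x : V) : ℕ → Option V ⊕ Option V
  | 0 => .inl none
  | 1 => .inl (some (f x))
  | 2 => .inr (some (g x))
  | _ + 3 => .inr none

theorem twoLevelGraph_adj_word (f g : V → V) (x : V) (i : ℕ) (hi : i < 3) :
    (twoLevelGraph f g).Adj (twoLevelWord f g x i) (twoLevelWord f g x (i + 1)) := by
  interval_cases i
  · exact trivial
  · exact ⟨x, rfl, rfl⟩
  · exact trivial

theorem twoLevelGraph_adj_inl_none {f g : V → V} {y : Option V ⊕ Option V}
    (h : (twoLevelGraph f g).Adj (.inl none) y) : ∃ u, y = .inl (some u) := by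
  rcases y with (_ | u) | (_ | u)
  · exact h.elim
  · exact ⟨u, rfl⟩
  · exact h.elim
  · exact h.elim

theorem twoLevelGraph_adj_inr_none {f g : V → V} {y : Option V ⊕ Option V}
    (h : (twoLevelGraph f g).Adj y (.inr none)) : ∃ u, y = .inr (some u) := by
  rcases y with (_ | u) | (_ | u)
  · exact h.elim
  · exact h.elim
  · exact h.elim
  · exact ⟨u, rfl⟩

theorem twoLevelGraph_three_le_length (f g : V → V)
    (p : (twoLevelGraph f g).Walk (.inl none) (.inr none)) : 3 ≤ p.length := by
  by_contra! hp
  have h0 : p.getVert 0 = .inl none := p.getVert_zero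
  have hl : p.getVert p.length = .inr none := p.getVert_length
  have hadj := fun i (hi : i < p.length) => p.adj_getVert_succ hi
  interval_cases p.length
  · rw [h0] at hl
    simp at hl
  · have h := hadj 0 (by omega)
    rw [h0, hl] at h
    exact h
  · have h := hadj 0 (by omega)
    have h' := hadj 1 (by omega)
    rw [h0] at h
    rw [hl] at h'
    obtain ⟨u, hu⟩ := twoLevelGraph_adj_inl_none h
    obtain ⟨v, hv⟩ := twoLevelGraph_adj_inr_none h'
    simp [hu] at hv

theorem twoLevelGraph_reachable_and_dist [Nonempty V] (f g : V → V) :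
    (twoLevelGraph f g).Reachable (.inl none) (.inr none) ∧
      (twoLevelGraph f g).dist (.inl none) (.inr none) = 3 := by
  obtain ⟨x⟩ := ‹Nonempty V›
  obtain ⟨p, hp, -⟩ := exists_walk_getVert_eq _ 3 (twoLevelGraph_adj_word f g x)
  have hr : (twoLevelGraph f g).Reachable (.inl none) (.inr none) := ⟨p⟩
  refine ⟨hr, le_antisymm (hp ▸ dist_le p) ?_⟩
  obtain ⟨q, hq⟩ := hr.exists_walk_length_eq_dist
  exact hq ▸ twoLevelGraph_three_le_length f g q

theorem exists_twoLevelWord_eq [Nonempty V] (f g : V → V)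
    (P : Geodesic (twoLevelGraph f g) (.inl none) (.inr none)) :
    ∃ x, P.1.getVert = twoLevelWord f g x := by
  have hd := (twoLevelGraph_reachable_and_dist f g).2
  have h0 : P.1.getVert 0 = .inl none := P.1.getVert_zero
  have h3 : ∀ i, 3 ≤ i → P.1.getVert i = .inr none := fun i hi =>
    P.getVert_of_dist_le (hd.trans_le hi)
  have a0 := P.adj_getVert_succ (i := 0) (by omega)
  have a1 := P.adj_getVert_succ (i := 1) (by omega)
  have a2 := P.adj_getVert_succ (i := 2) (by omega)
  rw [h0] at a0
  rw [h3 3 le_rfl] at a2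
  obtain ⟨u, hu⟩ := twoLevelGraph_adj_inl_none a0
  obtain ⟨v, hv⟩ := twoLevelGraph_adj_inr_none a2
  simp only [zero_add] at hu
  rw [hu, hv] at a1
  -- An edge between the two levels comes from some vertex of `H`, which identifies the geodesic.
  obtain ⟨x, rfl, rfl⟩ : ∃ x, f x = u ∧ g x = v := a1
  refine ⟨x, funext fun i => ?_⟩
  match i with
  | 0 => exact h0
  | 1 => exact hu
  | 2 => exact hv
  | i + 3 => exact h3 _ (by omega)

/-- Since `x` is determined by the pair `(f x, g x)`, geodesics correspond to vertices of `H`, and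
distinct ones differ in one letter exactly when one coordinate agrees. -/
theorem isBaseGraph_twoLevelGraph [Nonempty V] {H : SimpleGraph V} (f g : V → V)
    (hinj : ∀ x y, f x = f y → g x = g y → x = y)
    (hadj : ∀ x y, x ≠ y → (H.Adj x y ↔ f x = f y ∨ g x = g y)) :
    IsBaseGraph (twoLevelGraph f g) (.inl none) (.inr none) H := by
  refine ⟨by simp, ?_⟩
  have hd := (twoLevelGraph_reachable_and_dist f g).2
  have hex : ∀ x, ∃ P : Geodesic (twoLevelGraph f g) (.inl none) (.inr none),
      ∀ i, P.1.getVert i = twoLevelWord f g x i := by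
    intro x
    refine Geodesic.exists_getVert_eq _ rfl (fun i hi => ?_) fun i hi =>
      twoLevelGraph_adj_word f g x i (by omega)
    obtain ⟨j, rfl⟩ : ∃ j, i = j + 3 := ⟨i - 3, by omega⟩
    rfl
  choose F hF using hex
  have hword : ∀ x y i, i ≠ 1 → i ≠ 2 → twoLevelWord f g x i = twoLevelWord f g y i := by
    intro x y i h1 h2
    match i with
    | 0 => rfl
    | i + 3 => rfl
  have hFinj : Function.Injective F := by
    intro x y hxy
    have h : ∀ i, twoLevelWord f g x i = twoLevelWord f g y i := fun i => by
      rw [← hF, ← hF, hxy]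
    refine hinj x y ?_ ?_
    · simpa [twoLevelWord] using h 1
    · simpa [twoLevelWord] using h 2
  have hFsurj : Function.Surjective F := by
    intro P
    obtain ⟨x, hx⟩ := exists_twoLevelWord_eq f g P
    exact ⟨x, Geodesic.ext fun i => by rw [hF, hx]⟩
  refine ⟨⟨Equiv.ofBijective F ⟨hFinj, hFsurj⟩, ?_⟩⟩
  intro x y
  change (shortestPathGraph _ _ _).Adj (F x) (F y) ↔ _
  rw [shortestPathGraph_adj_iff, funext (hF x), funext (hF y)]
  have e1 : twoLevelWord f g x 1 = twoLevelWord f g y 1 ↔ f x = f y := by simp [twoLevelWord]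
  have e2 : twoLevelWord f g x 2 = twoLevelWord f g y 2 ↔ g x = g y := by simp [twoLevelWord]
  by_cases hxy : x = y
  · subst hxy
    simp [DifferOnlyAt]
  rw [hadj x y hxy]
  constructor
  · rintro ⟨i, hi, hoff⟩
    by_cases h1 : i = 1
    · exact .inr (e2.1 (hoff 2 (by omega)))
    · exact .inl (e1.1 (hoff 1 (Ne.symm h1)))
  · rintro (h | h)
    · refine ⟨2, fun h2 => hxy (hinj x y h (e2.1 h2)), fun j hj => ?_⟩
      by_cases h1 : j = 1
      · rw [h1, e1, h]
      · exact hword x y j h1 hj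
    · refine ⟨1, fun h1 => hxy (hinj x y (e1.1 h1) h), fun j hj => ?_⟩
      by_cases h2 : j = 2
      · rw [h2, e2, h]
      · exact hword x y j hj h2

end TwoLevels

/-! ### Odd cycles in graphs that are not bipartite. -/

section OddCycle

theorem exists_injective_odd_cycle_of_not_colorable_two {α : Type u} {G : SimpleGraph α}
    (hG : ¬ G.Colorable 2) : ∃ n, Odd (n + 3) ∧ ∃ M : Fin (n + 3) → α,
      Function.Injective M ∧ ∀ i, G.Adj (M i) (M (i + 1)) := by
  classical
  have hex : ∃ L, Odd L ∧ ∃ u, ∃ p : G.Walk u u, p.length = L := by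
    rw [two_colorable_iff_forall_loop_even] at hG
    push Not at hG
    obtain ⟨u, p, hp⟩ := hG
    exact ⟨p.length, by simpa using hp, u, p, rfl⟩
  obtain ⟨hodd, u, p, hp⟩ := Nat.find_spec hex
  have hmin : ∀ (v : α) (q : G.Walk v v), Odd q.length → Nat.find hex ≤ q.length :=
    fun v q hq => Nat.find_min' hex ⟨hq, v, q, rfl⟩
  generalize Nat.find hex = L at hodd hp hmin
  -- A repeated vertex splits a shortest odd closed walk into two shorter closed walks, one of them
  -- odd.
  have hlt : ∀ i j, i < j → j < L → p.getVert i ≠ p.getVert j := by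
    intro i j hij hjL h
    have h1 : Odd (j - i) → L ≤ j - i := by
      have := hmin _ (((p.drop i).take (j - i)).copy rfl (by
        rw [Walk.drop_getVert, Nat.add_sub_cancel' hij.le, h]))
      simp only [Walk.length_copy, Walk.take_length, Walk.drop_length] at this
      rwa [min_eq_left (by omega)] at this
    have h2 : Odd (i + (L - j)) → L ≤ i + (L - j) := by
      have := hmin _ ((p.take i).append ((p.drop j).copy h.symm rfl))
      simp only [Walk.length_append, Walk.length_copy, Walk.take_length, Walk.drop_length] at this
      rwa [min_eq_left (by omega), hp] at this
    simp only [Nat.odd_iff] at h1 h2 hodd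
    omega
  have hL : 3 ≤ L := by
    by_contra! hL
    have hL1 : L = 1 := by
      rw [Nat.odd_iff] at hodd
      omega
    have := p.adj_getVert_succ (i := 0) (by omega)
    rw [p.getVert_of_length_le (i := 0 + 1) (by omega), p.getVert_zero] at this
    exact G.loopless.irrefl _ this
  obtain ⟨n, rfl⟩ : ∃ n, L = n + 3 := ⟨L - 3, by omega⟩
  refine ⟨n, hodd, fun i => p.getVert i, fun i j hij => ?_, fun i => ?_⟩
  · rcases lt_trichotomy i j with h | h | h
    · exact (hlt i j h j.2 hij).elim
    · exact h
    · exact (hlt j i h i.2 hij.symm).elim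
  · have hadj := p.adj_getVert_succ (i := i) (i.2.trans_eq hp.symm)
    simp only [Fin.val_add_one]
    split_ifs with hi
    · rw [hi, Fin.val_last, p.getVert_of_length_le (i := n + 2 + 1) (by omega)] at hadj
      rwa [p.getVert_zero, hi, Fin.val_last]
    · exact hadj

end OddCycle

/-! ### Maximal cliques and their intersection graph. -/

section MaximalClique

variable {V : Type u} {H : SimpleGraph V}

theorem exists_maximal_isClique_superset [Finite V] {s : Set V} (hs : H.IsClique s) :
    ∃ t, Maximal H.IsClique t ∧ s ⊆ t := by
  obtain ⟨t, hst, ht⟩ := (Set.toFinite {t : Set V | H.IsClique t}).exists_le_maximal hs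
  exact ⟨t, ht, hst⟩

/-- Two maximal cliques of a collection of cliques that share two vertices are equal. -/
theorem IsCollectionOfCliques.eq_of_mem (hH : IsCollectionOfCliques H) {s t : Set V}
    (hs : Maximal H.IsClique s) (ht : Maximal H.IsClique t) {x y : V} (hxy : x ≠ y) (hxs : x ∈ s)
    (hys : y ∈ s) (hxt : x ∈ t) (hyt : y ∈ t) : s = t := by
  by_contra hst
  exact hxy (Set.encard_le_one_iff.1 (hH.2 s t hs ht hst) x y ⟨hxs, hxt⟩ ⟨hys, hyt⟩)

/-- A maximal clique containing the triangle shares `x` and `y` with `s`, hence equals `s`. -/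
theorem IsCollectionOfCliques.mem_of_adj [Finite V] (hH : IsCollectionOfCliques H) {s : Set V}
    (hs : Maximal H.IsClique s) {x y z : V} (hxy : x ≠ y) (hxs : x ∈ s) (hys : y ∈ s)
    (hxz : H.Adj x z) (hyz : H.Adj y z) : z ∈ s := by
  have hclique : H.IsClique {x, y, z} := by
    have := hs.prop hxs hys hxy
    simp [isClique_iff, Set.pairwise_insert, this, this.symm, hxz, hxz.symm, hyz, hyz.symm]
  obtain ⟨t, ht, hsub⟩ := exists_maximal_isClique_superset hclique
  rw [hH.eq_of_mem hs ht hxy hxs hys (hsub (by simp)) (hsub (by simp))]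
  exact hsub (by simp)

theorem exists_mem_ne_of_maximal_isClique {s t : Set V} (hs : Maximal H.IsClique s)
    (ht : Maximal H.IsClique t) (hst : s ≠ t) {v : V} (hvt : v ∈ t) :
    ∃ x ∈ s, x ≠ v := by
  by_contra! h
  exact hst (hs.eq_of_subset ht.prop fun x hx => h x hx ▸ hvt)

/-- No vertex of a collection of cliques lies in three maximal cliques. -/
theorem IsCollectionOfCliques.not_mem_three [Finite V] (hH : IsCollectionOfCliques H)
    {K : Fin 3 → Set V} (hK : ∀ i, Maximal H.IsClique (K i)) (hinj : Function.Injective K) {v : V} :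
    ¬ ∀ i, v ∈ K i := by
  intro hv
  -- One further vertex from each clique gives the leaves of a claw centred at `v`; an edge between
  -- two leaves would make their cliques share two vertices.
  have hex : ∀ i, ∃ x ∈ K i, x ≠ v := by
    intro i
    have hi : i ≠ i + 1 := by revert i; decide
    exact exists_mem_ne_of_maximal_isClique (hK i) (hK (i + 1)) (hinj.ne hi) (hv _)
  choose x hxK hxv using hex
  have hvx : ∀ i, H.Adj v (x i) := fun i => (hK i).prop (hv i) (hxK i) (hxv i).symm
  have hinj_x : Function.Injective x := by
    intro i j hij
    exact hinj (hH.eq_of_mem (hK i) (hK j) (hxv i) (hxK i) (hv i) (hij ▸ hxK j) (hv j))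
  have hnadj : ∀ i j, ¬ H.Adj (x i) (x j) := by
    intro i j hadj
    have hxj := hH.mem_of_adj (hK i) (hxv i).symm (hv i) (hxK i) (hvx j) hadj
    have := hinj (hH.eq_of_mem (hK i) (hK j) (hxv j) hxj (hv i) (hxK j) (hv j))
    exact hadj.ne (congrArg x this)
  refine hH.1 ⟨⟨⟨Sum.elim (fun _ => v) x, ?_⟩, ?_⟩⟩
  · rintro (i | i) (j | j) hij
    · rw [Subsingleton.elim i j]
    · exact (hxv j hij.symm).elim
    · exact (hxv i hij).elim
    · exact congrArg _ (hinj_x hij)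
  · intro i j
    change H.Adj (Sum.elim (fun _ => v) x i) (Sum.elim (fun _ => v) x j) ↔ _
    rcases i with i | i <;> rcases j with j | j
    · simp
    · simp [hvx]
    · simp [(hvx _).symm]
    · simp [hnadj]

theorem IsCollectionOfCliques.eq_or_eq_or_eq [Finite V] (hH : IsCollectionOfCliques H)
    {r s t : Set V} (hr : Maximal H.IsClique r) (hs : Maximal H.IsClique s)
    (ht : Maximal H.IsClique t) {v : V} (hvr : v ∈ r) (hvs : v ∈ s) (hvt : v ∈ t) :
    r = s ∨ r = t ∨ s = t := by
  by_contra! h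
  obtain ⟨hrs, hrt, hst⟩ := h
  refine hH.not_mem_three (K := ![r, s, t]) (v := v) (fun i => ?_) (fun i j hij => ?_) fun i => ?_
  · fin_cases i <;> assumption
  · fin_cases i <;> fin_cases j <;> simp_all
  · fin_cases i <;> assumption

/-- The intersection graph of the maximal cliques of `H`. -/
def maximalCliqueGraph (H : SimpleGraph V) : SimpleGraph {s : Set V // Maximal H.IsClique s} where
  Adj s t := s ≠ t ∧ ∃ v, v ∈ s.1 ∧ v ∈ t.1
  symm := ⟨fun _ _ h => ⟨h.1.symm, h.2.imp fun _ hv => hv.symm⟩⟩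
  loopless := ⟨fun _ h => h.1 rfl⟩

/-- Let `x i` be a common vertex of `M i` and `M (i + 1)`. It lies in no other maximal clique, so
the `x i` are distinct, and adjacent ones must share some `M l`, which makes them consecutive. -/
theorem IsCollectionOfCliques.exists_inducedCycle_of_cycle [Finite V]
    (hH : IsCollectionOfCliques H) {n : ℕ}
    {M : Fin (n + 3) → {s : Set V // Maximal H.IsClique s}} (hinj : Function.Injective M)
    (hM : ∀ i, (maximalCliqueGraph H).Adj (M i) (M (i + 1))) :
    n ≠ 0 ∧ ¬ InducedFree (cycleGraph (n + 3)) H := by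
  have h1 : (1 : Fin (n + 3)) ≠ 0 := by simp
  have h2 : (1 + 1 : Fin (n + 3)) ≠ 0 := by
    simp [Fin.ext_iff, Fin.val_add, Nat.mod_eq_of_lt (show 2 < n + 3 by omega)]
  have hinj' : ∀ i j, (M i).1 = (M j).1 → i = j := fun i j h => hinj (Subtype.ext h)
  choose x hx hx' using fun i => (hM i).2
  have hthree : ∀ (v : V) (i j k : Fin (n + 3)), v ∈ (M i).1 → v ∈ (M j).1 → v ∈ (M k).1 →
      i = j ∨ i = k ∨ j = k := fun v i j k hi hj hk =>
    (hH.eq_or_eq_or_eq (M i).2 (M j).2 (M k).2 hi hj hk).imp (hinj' _ _)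
      (Or.imp (hinj' _ _) (hinj' _ _))
  have hsucc : ∀ i : Fin (n + 3), i ≠ i + 1 := fun i h => h1 (left_eq_add.1 h)
  have hsucc' : ∀ i : Fin (n + 3), i ≠ i + 1 + 1 := fun i h => by
    rw [add_assoc i 1 1] at h
    exact h2 (left_eq_add.1 h)
  have hmem : ∀ i j, x i ∈ (M j).1 → j = i ∨ j = i + 1 := by
    intro i j hj
    rcases hthree (x i) j i (i + 1) hj (hx i) (hx' i) with h | h | h
    · exact .inl h
    · exact .inr h
    · exact (hsucc i h).elim
  have hxinj : Function.Injective x := by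
    intro i j hij
    rcases hmem i j (hij ▸ hx j) with h | h
    · exact h.symm
    rcases hmem i (j + 1) (hij ▸ hx' j) with h' | h'
    · rw [h] at h'
      exact (hsucc' i h'.symm).elim
    · exact (add_right_cancel h').symm
  have hadj : ∀ i, H.Adj (x i) (x (i + 1)) := fun i =>
    (M (i + 1)).2.prop (hx' i) (hx (i + 1)) (hxinj.ne (hsucc i))
  constructor
  -- For three cliques the `x i` form a triangle, which puts `x 2` into `M 1` as a third clique.
  · rintro rfl
    have h02 : H.Adj (x 2) (x 0) := hadj 2
    have h2M : x 2 ∈ (M 1).1 :=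
      hH.mem_of_adj (M 1).2 (hxinj.ne (show (0 : Fin 3) ≠ 1 by decide)) (hx' 0) (hx 1) h02.symm
        (hadj 1)
    have := hmem 2 1 h2M
    revert this
    decide
  · refine not_not.2 ⟨⟨⟨x, hxinj⟩, ?_⟩⟩
    intro i j
    change H.Adj (x i) (x j) ↔ _
    rw [cycleGraph_adj, sub_eq_iff_eq_add', sub_eq_iff_eq_add']
    constructor
    · intro h
      have hclique : H.IsClique {x i, x j} := by
        simp [isClique_iff, Set.pairwise_insert, h, h.symm]
      obtain ⟨K, hK, hsub⟩ := exists_maximal_isClique_superset hclique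
      have hiK : x i ∈ K := hsub (by simp)
      have hjK : x j ∈ K := hsub (by simp)
      have hcase : ∀ l, x l ∈ K → K = (M l).1 ∨ K = (M (l + 1)).1 := by
        intro l hl
        rcases hH.eq_or_eq_or_eq hK (M l).2 (M (l + 1)).2 hl (hx l) (hx' l) with h | h | h
        · exact .inl h
        · exact .inr h
        · exact (hsucc l (hinj' _ _ h)).elim
      have hij : i ≠ j := fun hij => h.ne (congrArg x hij)
      rcases hcase i hiK with hi | hi <;> rcases hcase j hjK with hj | hj
      · exact (hij (hinj' _ _ (hi.symm.trans hj))).elim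
      · exact .inl (hinj' _ _ (hi.symm.trans hj))
      · exact .inr (hinj' _ _ (hj.symm.trans hi))
      · exact (hij (add_right_cancel (hinj' _ _ (hi.symm.trans hj)))).elim
    · rintro (rfl | rfl)
      · exact (hadj j).symm
      · exact hadj i

theorem IsCollectionOfCliques.maximalCliqueGraph_colorable_two [Finite V]
    (hH : IsCollectionOfCliques H)
    (hodd : ∀ k : ℕ, Odd k → 5 ≤ k → InducedFree (cycleGraph k) H) :
    (maximalCliqueGraph H).Colorable 2 := by
  by_contra h
  obtain ⟨n, hn, M, hinj, hM⟩ := exists_injective_odd_cycle_of_not_colorable_two h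
  obtain ⟨hn0, hfree⟩ := hH.exists_inducedCycle_of_cycle hinj hM
  refine hfree (hodd _ hn ?_)
  rw [Nat.odd_iff] at hn
  omega

/-- A collection of cliques without odd holes is given by two maps: two distinct vertices are
adjacent iff they have the same image under exactly one of them. -/
theorem IsCollectionOfCliques.exists_two_maps [Finite V] (hH : IsCollectionOfCliques H)
    (hodd : ∀ k : ℕ, Odd k → 5 ≤ k → InducedFree (cycleGraph k) H) :
    ∃ f g : V → V, (∀ x y, f x = f y → g x = g y → x = y) ∧
      ∀ x y, x ≠ y → (H.Adj x y ↔ f x = f y ∨ g x = g y) := by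
  obtain ⟨C⟩ := hH.maximalCliqueGraph_colorable_two hodd
  -- The classes are the maximal cliques of colour `c`, completed by singletons; transitivity holds
  -- because distinct cliques of one colour are disjoint.
  let r (c : Fin 2) : Setoid V :=
    { r := fun x y => x = y ∨ ∃ K, C K = c ∧ x ∈ K.1 ∧ y ∈ K.1
      iseqv := by
        refine ⟨fun x => .inl rfl, ?_, ?_⟩
        · rintro x y (rfl | ⟨K, hK, hx, hy⟩)
          · exact .inl rfl
          · exact .inr ⟨K, hK, hy, hx⟩
        · rintro x y z (rfl | ⟨K, hK, hx, hy⟩) (rfl | ⟨K', hK', hy', hz⟩)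
          · exact .inl rfl
          · exact .inr ⟨K', hK', hy', hz⟩
          · exact .inr ⟨K, hK, hx, hy⟩
          · have hKK' : K = K' := by
              by_contra hne
              exact C.valid (show (maximalCliqueGraph H).Adj K K' from ⟨hne, y, hy, hy'⟩)
                (hK.trans hK'.symm)
            subst hKK'
            exact .inr ⟨K, hK, hx, hz⟩ }
  let q (c : Fin 2) (x : V) : V := (Quotient.mk (r c) x).out
  have hq : ∀ c x y, q c x = q c y ↔ x = y ∨ ∃ K, C K = c ∧ x ∈ K.1 ∧ y ∈ K.1 := fun c x y =>
    Quotient.out_inj.trans (Quotient.eq (r := r c))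
  refine ⟨q 0, q 1, fun x y h0 h1 => ?_, fun x y hxy => ?_⟩
  · rw [hq] at h0 h1
    rcases h0 with h0 | ⟨K, hK, hx, hy⟩
    · exact h0
    rcases h1 with h1 | ⟨K', hK', hx', hy'⟩
    · exact h1
    by_contra hxy
    -- Two vertices identified by both maps would lie in one clique having both colours.
    have : K = K' := Subtype.ext (hH.eq_of_mem K.2 K'.2 hxy hx hy hx' hy')
    rw [this, hK'] at hK
    exact absurd hK (by decide)
  · rw [hq, hq]
    constructor
    · intro h
      have hclique : H.IsClique {x, y} := by
        simp [isClique_iff, Set.pairwise_insert, h, h.symm]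
      obtain ⟨K, hK, hsub⟩ := exists_maximal_isClique_superset hclique
      have hx : x ∈ K := hsub (by simp)
      have hy : y ∈ K := hsub (by simp)
      rcases Fin.exists_fin_two.1 ⟨C ⟨K, hK⟩, rfl⟩ with h | h
      · exact .inl (.inr ⟨⟨K, hK⟩, h, hx, hy⟩)
      · exact .inr (.inr ⟨⟨K, hK⟩, h, hx, hy⟩)
    · rintro ((h | ⟨K, -, hx, hy⟩) | (h | ⟨K, -, hx, hy⟩))
      · exact (hxy h).elim
      · exact K.2.prop hx hy hxy
      · exact (hxy h).elim
      · exact K.2.prop hx hy hxy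

end MaximalClique

theorem IsSPG.isCollectionOfCliques {V : Type u} {H : SimpleGraph V} (h : IsSPG H)
    (hH : InducedFree (cycleGraph 4) H) :
    IsCollectionOfCliques H ∧
      ∀ k : ℕ, Odd k → 5 ≤ k → InducedFree (cycleGraph k) H := by
  obtain ⟨W, -, G, a, b, hbase⟩ := h
  obtain ⟨w⟩ := hbase.nonempty_wordRepresentation
  exact ⟨⟨w.inducedFree_claw hH, fun s t hs ht hst => w.maximal_isClique_inter hs ht hst⟩,
    fun k hk hk5 => w.inducedFree_cycleGraph_of_odd hH hk hk5⟩

theorem IsCollectionOfCliques.exists_isBaseGraph {V : Type u} [Finite V] [Nonempty V]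
    {H : SimpleGraph V} (hH : IsCollectionOfCliques H)
    (hodd : ∀ k : ℕ, Odd k → 5 ≤ k → InducedFree (cycleGraph k) H) :
    ∃ (W : Type u) (_ : Finite W) (G : SimpleGraph W) (a b : W),
      IsBaseGraph G a b H ∧ HasIndexLevels G a b 2 := by
  obtain ⟨f, g, hinj, hadj⟩ := hH.exists_two_maps hodd
  exact ⟨_, inferInstance, twoLevelGraph f g, _, _, isBaseGraph_twoLevelGraph f g hinj hadj,
    twoLevelGraph_reachable_and_dist f g⟩

end ShortestPathGraph

theorem mainTheorem1 {V : Type u} [Finite V] [Nonempty V] (H : SimpleGraph V)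
    (hH : ShortestPathGraph.InducedFree (SimpleGraph.cycleGraph 4) H) :
    (ShortestPathGraph.IsSPG H ↔
      ShortestPathGraph.IsCollectionOfCliques H ∧
        ∀ k : ℕ, Odd k → 5 ≤ k → ShortestPathGraph.InducedFree (SimpleGraph.cycleGraph k) H) ∧
    (ShortestPathGraph.IsSPG H →
      ∃ (W : Type u) (_ : Finite W) (G : SimpleGraph W) (a b : W),
        ShortestPathGraph.IsBaseGraph G a b H ∧ ShortestPathGraph.HasIndexLevels G a b 2) := by
  refine ⟨⟨fun h => h.isCollectionOfCliques hH, fun h => ?_⟩, fun h => ?_⟩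
  · obtain ⟨W, hW, G, a, b, hbase, -⟩ := h.1.exists_isBaseGraph h.2
    exact ⟨W, hW, G, a, b, hbase⟩
  · obtain ⟨hcol, hodd⟩ := h.isCollectionOfCliques hH
    exact hcol.exists_isBaseGraph hodd
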